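/- **Setting.** Let $d\ge 1$. A *slicing schedule* is a sequence $\mathcal S=((b_k,s_k))_{k\ge1}$ of finite binary words $b_k$ and unit vectors $s_k\in\mathbb R^d$ such that $b_{k}\in L_{k-1}$ for all $k\ge 1$, where $L_0=\{0\}$ and $L_{k}=(L_{k-1}\setminus\{b_{k}\})\cup\{b_{k}0,b_{k}1\}$. A Borel probability measure $\mu\ll dx$ on $\mathbb R^d$ is *sliced* according to $\mathcal S$ as follows: $\Omega^\mu_0=\mathbb R^d$, and at step $k$ one picks $h_k=h_k^\mu\in\mathbb R$ such that $$\mu(x\cdot s_k\le h_k\mid\Omega^\mu_{b_k})=\mu(x\cdot s_k> h_k\mid\Omega^\mu_{b_k})=\tfrac12,$$ and puts $\Omega^\mu_{b_k0}=\Omega^\mu_{b_k}\cap\{x\cdot s_k\le h_k\}$, $\Omega^\mu_{b_k1}=\Omega^\mu_{b_k}\cap\{x\cdot s_k>h_k\}$. Let $\ell^\mu_k(x)=\sum_{\alpha=0}^m i_\alpha 3^{-\alpha}$ for $x\in\Omega^\mu_{i_0i_1\cdots i_m}$, $i_0i_1\cdots i_m\in L_k$, and $\ell^\mu=\lim_{k\to\infty}\ell^\mu_k$.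 The schedule is *admissible* if all $s_k$ belong to some basis $\{e_1,\dots,e_d\}$ of $\mathbb R^d$ and every set that appears during the partition is further cut in each of the directions $e_i$ infinitely many times, in the sense that for every infinite binary sequence $\omega=i_0i_1i_2\cdots$ with $i_0=0$ and every $i$, there are infinitely many $k$ such that $b_k$ is an initial segment of $\omega$ and $s_k=e_i$. Let $\mathcal K$ be the set of compactly supported probability measures $d\mu=f\,dx$ on $\mathbb R^d$ with $\mu(\partial(\mathrm{supp}\,\mu))=0$ and $c_\mu\le f\le C_\mu$ $\mu$-a.e. for some constants $c_\mu,C_\mu>0$. For $\mu,\nu\in\mathcal K$ let $t_\mu^\nu(x)$ be the unique $y\in\mathrm{int}(\mathrm{supp}\,\nu)$ with $\ell^\nu(y)=\ell^\mu(x)$, for those $x$ for which there is exactly one such $y$ (and $t_\mu^\nu(x)=0$, say, for the other $x$), and for $p\ge1$ let $$W_{\mathcal S,p}(\mu,\nu)=\Big(\int_{\mathbb R^d}|t_\mu^\nu(x)-x|^p\,d\mu(x)\Big)^{1/p}.$$ **Statement.** Let $\mathcal S$ be an admissible schedule. Every Borel probability measure $\mu\ll dx$ can be sliced according to $\mathcal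 S$. Fix, for each $\mu\in\mathcal K$, an arbitrary choice of thresholds $(h^\mu_k)_k$ that slices $\mu$. Then for all $\mu,\nu\in\mathcal K$ the point $y$ that defines $t_\mu^\nu(x)$ exists and is unique for $\mu$-a.e. $x$. Moreover, let $\sigma$ be the uniform probability measure on $[0,1]^d$ and let $1\le p<\infty$. Then: 1. $t_\sigma^\mu\in L^p(\sigma;\mathbb R^d)$ for all $\mu\in\mathcal K$, and $\mu\mapsto t_\sigma^\mu$ is an injection from $\mathcal K$ into $L^p(\sigma;\mathbb R^d)$. 2. $t_\mu^\nu-\mathrm{id}\in L^p(\mu;\mathbb R^d)$ for all $\mu,\nu\in\mathcal K$ (so that $W_{\mathcal S,p}$ is finite), and $(\mathcal K,W_{\mathcal S,p})$ is a metric space. -/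

import Mathlib

open MeasureTheory Set Filter Topology
open scoped ENNReal

namespace NoCollision

/-- The Euclidean space `ℝ^d`. -/
abbrev E (d : ℕ) : Type := EuclideanSpace ℝ (Fin d)

/-- Words `i₀ i₁ … i_m` with digits in `{0, 1}`; they index the pieces of the partitions. -/
abbrev Word : Type := List (Fin 2)

/-- The words that index the pieces present after `k` cuts, when the piece cut at the
`(k+1)`-st step is the one with index `b k`. The whole space has index `0`. -/
def leaves (b : ℕ → Word) : ℕ → Finset Word
  | 0 => {[0]}
  | k + 1 => (leaves b k).erase (b k) ∪ {b k ++ [0], b k ++ [1]}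

/-- A slicing schedule: at step `k + 1` the existing piece with index `b k` is cut in the
direction of the unit vector `s k`. -/
structure SlicingSchedule (d : ℕ) where
  b : ℕ → Word
  s : ℕ → E d
  norm_s : ∀ k, ‖s k‖ = 1
  b_mem : ∀ k, b k ∈ leaves b k

/-- The pieces obtained after `k` cuts, when the cut at step `k + 1` is made along the
hyperplane `{x | x · s k = h k}`. Only the values at words in `leaves S.b k` matter. -/
noncomputable def cell {d : ℕ} (S : SlicingSchedule d) (h : ℕ → ℝ) : ℕ → Word → Set (E d)
  | 0, w => if w = [0] then univ else ∅
  | k + 1, w =>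
      if w = S.b k ++ [0] then {x | inner ℝ x (S.s k) ≤ h k} ∩ cell S h k (S.b k)
      else if w = S.b k ++ [1] then {x | h k < inner ℝ x (S.s k)} ∩ cell S h k (S.b k)
      else cell S h k w

/-- The thresholds `h` slice `μ` according to `S`: every cut halves the mass of the piece. -/
def IsSlicing {d : ℕ} (S : SlicingSchedule d) (μ : Measure (E d)) (h : ℕ → ℝ) : Prop :=
  ∀ k, ProbabilityTheory.cond μ (cell S h k (S.b k)) {x | inner ℝ x (S.s k) ≤ h k} = 1 / 2 ∧
    ProbabilityTheory.cond μ (cell S h k (S.b k)) {x | h k < inner ℝ x (S.s k)} = 1 / 2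

/-- The number `∑ α, i_α / 3 ^ α` of a word `i₀ i₁ … i_m`. -/
noncomputable def code (w : Word) : ℝ :=
  ∑ α : Fin w.length, ((w.get α : ℕ) : ℝ) / 3 ^ (α : ℕ)

/-- The step function equal to `code w` on each piece with index `w` after `k` cuts. -/
noncomputable def ellStep {d : ℕ} (S : SlicingSchedule d) (h : ℕ → ℝ) (k : ℕ) (x : E d) : ℝ :=
  ∑ w ∈ leaves S.b k, (cell S h k w).indicator (fun _ => code w) x

/-- The pointwise limit of the step functions `ellStep S h k` as `k → ∞`. -/
noncomputable def ell {d : ℕ} (S : SlicingSchedule d) (h : ℕ → ℝ) (x : E d) : ℝ :=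
  limUnder atTop (fun k => ellStep S h k x)

/-- Admissible schedules: the directions belong to a basis, and along every infinite
sequence `ω` of successive pieces (`ω 0 = 0`; the pieces are indexed by the initial segments
of `ω`) cuts are made in each direction of the basis infinitely many times. -/
def SlicingSchedule.Admissible {d : ℕ} (S : SlicingSchedule d) : Prop :=
  ∃ e : Module.Basis (Fin d) ℝ (E d), (∀ k, S.s k ∈ range e) ∧
    ∀ ω : ℕ → Fin 2, ω 0 = 0 → ∀ i : Fin d,
      {k : ℕ | S.s k = e i ∧ ∃ m : ℕ, S.b k = List.ofFn (fun j : Fin m => ω j)}.Infinite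

/-- The class `𝒦` of compactly supported probability measures with a density `f`, with
`μ (∂ (supp μ)) = 0` and `f` bounded above and below by positive constants `μ`-a.e. -/
def calK (d : ℕ) : Set (Measure (E d)) :=
  {μ | IsProbabilityMeasure μ ∧ IsCompact μ.support ∧ μ (frontier μ.support) = 0 ∧
    ∃ f : E d → ℝ, Measurable f ∧ (∀ x, 0 ≤ f x) ∧
      μ = volume.withDensity (fun x => ENNReal.ofReal (f x)) ∧
      ∃ c C : ℝ, 0 < c ∧ 0 < C ∧ ∀ᵐ x ∂μ, c ≤ f x ∧ f x ≤ C}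

/-- `y` is a point of `int (supp ν)` with `ℓ^ν(y) = ℓ^μ(x)`. The thresholds used for a measure
`μ` are `h μ`. -/
def Matches {d : ℕ} (S : SlicingSchedule d) (h : Measure (E d) → ℕ → ℝ)
    (μ ν : Measure (E d)) (x y : E d) : Prop :=
  y ∈ interior ν.support ∧ ell S (h ν) y = ell S (h μ) x

open Classical in
/-- The no-collision map `t_μ^ν(x) = (ℓ^ν)⁻¹(ℓ^μ(x))`, where the inverse is taken in
`int (supp ν)`; it is given the value `0` where this preimage is not a single point. -/
noncomputable def tMap {d : ℕ} (S : SlicingSchedule d) (h : Measure (E d) → ℕ → ℝ)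
    (μ ν : Measure (E d)) (x : E d) : E d :=
  if hx : ∃! y, Matches S h μ ν x y then hx.choose else 0

/-- The no-collision distance `W_{𝒮,p}`. -/
noncomputable def W {d : ℕ} (S : SlicingSchedule d) (h : Measure (E d) → ℕ → ℝ) (p : ℝ)
    (μ ν : Measure (E d)) : ℝ :=
  (∫ x, ‖tMap S h μ ν x - x‖ ^ p ∂μ) ^ (1 / p)

/-- The uniform probability measure on `[0,1]^d`. -/
noncomputable def uniformCube (d : ℕ) : Measure (E d) :=
  volume.restrict {x | ∀ i, x i ∈ Icc (0 : ℝ) 1}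

end NoCollision

namespace NoCollision

/-! ### Words and pieces -/

/-! Two facts about the code `ell` carry the theorem. First, its law does not depend on the measure:
each cut halves the mass of a piece, so the mass of the piece with a given index depends only on the
schedule (`IsSlicing.map_ell_eq`). Second, for a measure in `calK` almost every point is determined
by its code among the points of the interior of the support (`IsSlicing.ae_eq_of_ell_eq`).

For the second fact, equal codes mean equal pieces at every stage, because base 3 with digits 0 and
1 leaves gaps (`leaf_eq_of_ell_eq`). The pieces are boxes in the dual coordinates, so it suffices
that every side shrinks to length 0 (`ae_tendsto_width`). Let V be Lebesgue measure on a large box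
in those coordinates. The ratios V(piece)/ν(piece) form a nonnegative martingale, hence converge
a.e. to a finite limit l, and l > 0 because ν has bounded density. A cut in direction `e i` halves
the ν-mass and changes V only through the i-th width. If the i-th widths decrease to u, infinitely
many such cuts give l u = 2 l u, so u = 0.

Consequently `tMap S h μ ν` is a.e. a measurable inverse of the code of ν composed with the code of
μ (`exists_tMap_ae_eq`). It pushes μ to ν, and such maps compose. Changing variables along the map
from σ to μ turns `W` into the L^p(σ) distance between the maps from σ (`W_eq_norm_sub`). These maps
determine their targets as pushforwards of σ, so `W` is a metric induced by an injection. -/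

lemma mem_leaves_succ {b : ℕ → Word} {k : ℕ} {w : Word} :
    w ∈ leaves b (k + 1) ↔ (w ≠ b k ∧ w ∈ leaves b k) ∨ ∃ a, w = b k ++ [a] := by
  simp [leaves, Fin.exists_fin_two]
  tauto

/-- At most one current piece lies on a given infinite path. This makes both children of a cut piece
new words, and identifies the piece that an admissible schedule cuts along a path. -/
lemma leaves_prefix_free {b : ℕ → Word} (hb : ∀ k, b k ∈ leaves b k) (k : ℕ) :
    ∀ u ∈ leaves b k, ∀ v ∈ leaves b k, u <+: v → u = v := by
  induction k with
  | zero => simp [leaves]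
  | succ k ih =>
    intro u hu v hv huv
    rw [mem_leaves_succ] at hu hv
    rcases hu with ⟨hu, hu'⟩ | ⟨a, rfl⟩ <;> rcases hv with ⟨hv, hv'⟩ | ⟨c, rfl⟩
    · exact ih u hu' v hv' huv
    · rcases List.prefix_concat_iff.1 huv with h | h
      · exact h
      · exact absurd (ih u hu' _ (hb k) h) hu
    · exact absurd (ih _ (hb k) v hv' ((List.prefix_append _ _).trans huv)).symm hv
    · exact huv.eq_of_length (by simp)

lemma concat_notMem_leaves {b : ℕ → Word} (hb : ∀ k, b k ∈ leaves b k) (k : ℕ) (a : Fin 2) :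
    b k ++ [a] ∉ leaves b k := fun h => by
  simpa using leaves_prefix_free hb k _ (hb k) _ h (List.prefix_append _ _)

lemma code_concat (w : Word) (a : Fin 2) :
    code (w ++ [a]) = code w + ((a : ℕ) : ℝ) / 3 ^ w.length := by
  have key : ∀ u : Word, code u = ∑ i ∈ Finset.range u.length, ((u.getD i 0 : ℕ) : ℝ) / 3 ^ i := by
    intro u
    rw [Finset.sum_range, code]
    refine Finset.sum_congr rfl fun i _ => ?_
    simp
  rw [key, key, List.length_append, List.length_singleton, Finset.sum_range_succ]
  congr 1
  · refine Finset.sum_congr rfl fun i hi => ?_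
    rw [List.getD_append _ _ _ _ (Finset.mem_range.1 hi)]
  · simp

/-- Sequences of words in which every word is the previous one, possibly with a digit appended. -/
def IsRefining (u : ℕ → Word) : Prop := ∀ k, u (k + 1) = u k ∨ ∃ a, u (k + 1) = u k ++ [a]

lemma IsRefining.isPrefix {u : ℕ → Word} (hu : IsRefining u) {j k : ℕ} (h : j ≤ k) : u j <+: u k := by
  induction k, h using Nat.le_induction with
  | base => exact List.prefix_rfl
  | succ k _ ih =>
    rcases hu k with h | ⟨a, h⟩ <;> rw [h]
    · exact ih
    · exact ih.trans (List.prefix_append _ _)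

lemma IsRefining.monotone_code {u : ℕ → Word} (hu : IsRefining u) :
    Monotone fun k => code (u k) := by
  refine monotone_nat_of_le_succ fun k => ?_
  rcases hu k with h | ⟨a, h⟩ <;> rw [h]
  rw [code_concat]
  have : (0 : ℝ) ≤ ((a : ℕ) : ℝ) / 3 ^ (u k).length := by positivity
  linarith

/-- The added term is the full geometric tail `∑ 3 ^ (-α)` over `α ≥ (u k).length`, the most that
all later digits can contribute. -/
lemma IsRefining.antitone_code_add {u : ℕ → Word} (hu : IsRefining u) :
    Antitone fun k => code (u k) + 3 / 2 / 3 ^ (u k).length := by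
  refine antitone_nat_of_succ_le fun k => ?_
  rcases hu k with h | ⟨a, h⟩ <;> simp only [h, le_refl]
  rw [code_concat, List.length_append, List.length_singleton, pow_succ]
  have h1 : ((a : ℕ) : ℝ) ≤ 1 := by exact_mod_cast Nat.lt_succ_iff.1 a.2
  have h2 : (0 : ℝ) < 1 / 3 ^ (u k).length := by positivity
  have h3 : ((a : ℕ) : ℝ) / 3 ^ (u k).length = (a : ℕ) * (1 / 3 ^ (u k).length) := by ring
  have h4 : (3 : ℝ) / 2 / (3 ^ (u k).length * 3) = 1 / 2 * (1 / 3 ^ (u k).length) := by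
    field_simp
  have h5 : (3 : ℝ) / 2 / (3 ^ (u k).length) = 3 / 2 * (1 / 3 ^ (u k).length) := by ring
  rw [h3, h4, h5]
  nlinarith

lemma IsRefining.exists_tendsto {u : ℕ → Word} (hu : IsRefining u) :
    ∃ l, Tendsto (fun k => code (u k)) atTop (𝓝 l) := by
  refine ⟨_, tendsto_atTop_ciSup hu.monotone_code ⟨code (u 0) + 3 / 2 / 3 ^ (u 0).length, ?_⟩⟩
  rintro _ ⟨k, rfl⟩
  have h1 := hu.antitone_code_add (Nat.zero_le k)
  have h2 : (0 : ℝ) ≤ 3 / 2 / 3 ^ (u k).length := by positivity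
  simp only at h1 ⊢
  linarith

/-- With n the length of `w`, all digits after `w0` together add at most half of 3⁻ⁿ, while `w1`
already adds 3⁻ⁿ. In base 2 the two could coincide. -/
lemma IsRefining.lim_lt_lim {u v : ℕ → Word} (hu : IsRefining u) (hv : IsRefining v) {l m : ℝ}
    (hl : Tendsto (fun k => code (u k)) atTop (𝓝 l))
    (hm : Tendsto (fun k => code (v k)) atTop (𝓝 m)) {k : ℕ} {w : Word}
    (h0 : u k = w ++ [0]) (h1 : v k = w ++ [1]) : l < m := by
  have hl' : l ≤ code w + 3 / 2 / 3 ^ (w.length + 1) := by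
    refine le_of_tendsto hl (eventually_atTop.2 ⟨k, fun j hj => ?_⟩)
    have h1 := hu.antitone_code_add hj
    have h2 : (0 : ℝ) ≤ 3 / 2 / 3 ^ (u j).length := by positivity
    simp only [h0, code_concat, List.length_append, List.length_singleton] at h1
    simp only [Fin.val_zero, Nat.cast_zero, zero_div, add_zero] at h1
    linarith
  have hm' : code w + 1 / 3 ^ w.length ≤ m := by
    refine ge_of_tendsto hm (eventually_atTop.2 ⟨k, fun j hj => ?_⟩)
    have h2 := hv.monotone_code hj
    simpa [h1, code_concat] using h2
  have h2 : (0 : ℝ) < 1 / 3 ^ w.length := by positivity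
  have h4 : (3 : ℝ) / 2 / (3 ^ (w.length + 1)) = 1 / 2 * (1 / 3 ^ w.length) := by
    rw [pow_succ]; field_simp
  linarith

variable {d : ℕ}

open Classical in
/-- The index of the piece that contains `x` after `k` cuts. -/
noncomputable def leaf (S : SlicingSchedule d) (h : ℕ → ℝ) (x : E d) : ℕ → Word
  | 0 => [0]
  | k + 1 =>
      if leaf S h x k = S.b k then
        if inner ℝ x (S.s k) ≤ h k then S.b k ++ [0] else S.b k ++ [1]
      else leaf S h x k

variable {S : SlicingSchedule d} {h h' : ℕ → ℝ} {x y : E d}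

lemma leaf_succ_of_eq_of_le {k : ℕ} (hk : leaf S h x k = S.b k) (hx : inner ℝ x (S.s k) ≤ h k) :
    leaf S h x (k + 1) = S.b k ++ [0] := by
  rw [leaf, if_pos hk, if_pos hx]

lemma leaf_succ_of_eq_of_lt {k : ℕ} (hk : leaf S h x k = S.b k) (hx : h k < inner ℝ x (S.s k)) :
    leaf S h x (k + 1) = S.b k ++ [1] := by
  rw [leaf, if_pos hk, if_neg hx.not_ge]

lemma exists_leaf_succ_of_eq {k : ℕ} (hk : leaf S h x k = S.b k) :
    ∃ a, leaf S h x (k + 1) = S.b k ++ [a] := by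
  rcases le_or_gt (inner ℝ x (S.s k)) (h k) with hx | hx
  · exact ⟨0, leaf_succ_of_eq_of_le hk hx⟩
  · exact ⟨1, leaf_succ_of_eq_of_lt hk hx⟩

lemma leaf_succ_of_ne {k : ℕ} (hk : leaf S h x k ≠ S.b k) :
    leaf S h x (k + 1) = leaf S h x k := by
  rw [leaf, if_neg hk]

lemma isRefining_leaf : IsRefining (leaf S h x) := fun k => by
  by_cases hk : leaf S h x k = S.b k
  · rw [hk]; exact Or.inr (exists_leaf_succ_of_eq hk)
  · exact Or.inl (leaf_succ_of_ne hk)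

lemma leaf_mem (k : ℕ) : leaf S h x k ∈ leaves S.b k := by
  induction k with
  | zero => simp [leaf, leaves]
  | succ k ih =>
    rw [mem_leaves_succ]
    by_cases hk : leaf S h x k = S.b k
    · exact Or.inr (exists_leaf_succ_of_eq hk)
    · rw [leaf_succ_of_ne hk]
      exact Or.inl ⟨hk, ih⟩

/-- The piece from which the piece with index `w` present after `k + 1` cuts was obtained. -/
def parent (S : SlicingSchedule d) (k : ℕ) (w : Word) : Word :=
  if w = S.b k ++ [0] ∨ w = S.b k ++ [1] then S.b k else w

lemma parent_concat (k : ℕ) (a : Fin 2) : parent S k (S.b k ++ [a]) = S.b k := by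
  fin_cases a <;> simp [parent]

lemma parent_of_mem {k : ℕ} {w : Word} (hw : w ∈ leaves S.b k) : parent S k w = w := by
  rw [parent, if_neg]
  rintro (rfl | rfl) <;> exact concat_notMem_leaves S.b_mem k _ hw

lemma parent_leaf_succ (k : ℕ) : parent S k (leaf S h x (k + 1)) = leaf S h x k := by
  by_cases hk : leaf S h x k = S.b k
  · obtain ⟨a, ha⟩ := exists_leaf_succ_of_eq hk
    rw [ha, parent_concat, hk]
  · rw [leaf_succ_of_ne hk, parent_of_mem (leaf_mem k)]

lemma cell_succ_zero (k : ℕ) :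
    cell S h (k + 1) (S.b k ++ [0]) = {x | inner ℝ x (S.s k) ≤ h k} ∩ cell S h k (S.b k) := by
  simp [cell]

lemma cell_succ_one (k : ℕ) :
    cell S h (k + 1) (S.b k ++ [1]) = {x | h k < inner ℝ x (S.s k)} ∩ cell S h k (S.b k) := by
  simp [cell]

lemma cell_succ_of_mem {k : ℕ} {w : Word} (hw : w ∈ leaves S.b k) :
    cell S h (k + 1) w = cell S h k w := by
  rw [cell, if_neg, if_neg] <;> rintro rfl <;> exact concat_notMem_leaves S.b_mem k _ hw

/-- This replaces the recursion on sets by the path of a single point; in particular the current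
pieces partition the space. -/
lemma mem_cell_iff {k : ℕ} : ∀ {w : Word}, w ∈ leaves S.b k →
    (x ∈ cell S h k w ↔ leaf S h x k = w) := by
  induction k with
  | zero => intro w hw; simp_all [leaf, leaves, cell]
  | succ k ih =>
    intro w hw
    rcases mem_leaves_succ.1 hw with ⟨hne, hw'⟩ | ⟨a, rfl⟩
    · rw [cell_succ_of_mem hw', ih hw']
      by_cases hk : leaf S h x k = S.b k
      · obtain ⟨a, ha⟩ := exists_leaf_succ_of_eq hk
        rw [ha, hk]
        refine ⟨fun h => absurd h.symm hne, ?_⟩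
        rintro rfl
        exact absurd hw' (concat_notMem_leaves S.b_mem k _)
      · rw [leaf_succ_of_ne hk]
    · by_cases hk : leaf S h x k = S.b k
      · have hc : x ∈ cell S h k (S.b k) := (ih (S.b_mem k)).2 hk
        rcases le_or_gt (inner ℝ x (S.s k)) (h k) with hx | hx
        · rw [leaf_succ_of_eq_of_le hk hx]
          fin_cases a
          · simp [cell_succ_zero, hx, hc]
          · simp [cell_succ_one, hx]
        · rw [leaf_succ_of_eq_of_lt hk hx]
          fin_cases a
          · simp [cell_succ_zero, hx]
          · simp [cell_succ_one, hx, hc]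
      · have hc : x ∉ cell S h k (S.b k) := fun hc => hk ((ih (S.b_mem k)).1 hc)
        have hl : leaf S h x (k + 1) ≠ S.b k ++ [a] := by
          rw [leaf_succ_of_ne hk]
          intro h
          exact concat_notMem_leaves S.b_mem k a (h ▸ leaf_mem k)
        refine iff_of_false (fun h => hc ?_) hl
        fin_cases a
        · exact ((cell_succ_zero (S := S) k).subset h).2
        · exact ((cell_succ_one (S := S) k).subset h).2

lemma ellStep_eq (k : ℕ) : ellStep S h k x = code (leaf S h x k) := by
  classical
  rw [ellStep, Finset.sum_eq_single (leaf S h x k)]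
  · rw [indicator_of_mem ((mem_cell_iff (leaf_mem k)).2 rfl)]
  · intro w hw hne
    rw [indicator_of_notMem]
    exact fun hx => hne ((mem_cell_iff hw).1 hx).symm
  · exact fun hn => absurd (leaf_mem k) hn

lemma tendsto_ellStep : Tendsto (fun k => ellStep S h k x) atTop (𝓝 (ell S h x)) := by
  refine tendsto_nhds_limUnder ?_
  simpa only [ellStep_eq] using isRefining_leaf.exists_tendsto

/-- Points with the same limit code lie in pieces with the same indices. -/
lemma leaf_eq_of_ell_eq (he : ell S h x = ell S h' y) (k : ℕ) :
    leaf S h x k = leaf S h' y k := by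
  have hx := tendsto_ellStep (S := S) (h := h) (x := x)
  have hy := tendsto_ellStep (S := S) (h := h') (x := y)
  simp only [ellStep_eq] at hx hy
  induction k with
  | zero => rfl
  | succ k ih =>
    by_cases hk : leaf S h x k = S.b k
    · obtain ⟨a, ha⟩ := exists_leaf_succ_of_eq hk
      obtain ⟨c, hc⟩ := exists_leaf_succ_of_eq (ih ▸ hk)
      fin_cases a <;> fin_cases c
      · rw [ha, hc]
      · exact absurd he (isRefining_leaf.lim_lt_lim isRefining_leaf hx hy ha hc).ne
      · exact absurd he (isRefining_leaf.lim_lt_lim isRefining_leaf hy hx hc ha).ne'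
      · rw [ha, hc]
    · rw [leaf_succ_of_ne hk, leaf_succ_of_ne (ih ▸ hk), ih]

lemma measurableSet_cell (k : ℕ) : ∀ w, MeasurableSet (cell S h k w) := by
  induction k with
  | zero => intro w; rw [cell]; split_ifs <;> simp
  | succ k ih =>
    intro w
    rw [cell]
    split_ifs
    · exact (measurableSet_le (by fun_prop) (by fun_prop)).inter (ih _)
    · exact (measurableSet_lt (by fun_prop) (by fun_prop)).inter (ih _)
    · exact ih _

lemma measurable_ellStep (k : ℕ) : Measurable (ellStep S h k) := by
  unfold ellStep
  exact Finset.measurable_fun_sum _ fun w _ => measurable_const.indicator (measurableSet_cell k w)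

lemma measurable_ell : Measurable (ell S h) :=
  measurable_of_tendsto_metrizable measurable_ellStep
    (tendsto_pi_nhds.2 fun _ => tendsto_ellStep)

/-- Along an admissible schedule the piece that contains a given point is cut infinitely often in
each direction of the basis. -/
lemma frequently_cut {e : Module.Basis (Fin d) ℝ (E d)}
    (hS : ∀ ω : ℕ → Fin 2, ω 0 = 0 → ∀ i : Fin d,
      {k : ℕ | S.s k = e i ∧ ∃ m : ℕ, S.b k = List.ofFn (fun j : Fin m => ω j)}.Infinite)
    (x : E d) (i : Fin d) :
    ∃ᶠ k in atTop, S.s k = e i ∧ S.b k = leaf S h x k := by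
  classical
  -- The words on the path of `x` extend each other, so each digit is fixed once it appears. The
  -- digit 0 is a default for positions that the path might never reach.
  have hω : ∀ n, ∃ a : Fin 2, ∀ k, ∀ hn : n < (leaf S h x k).length, (leaf S h x k)[n] = a := by
    intro n
    by_cases hn : ∃ k, n < (leaf S h x k).length
    · obtain ⟨k, hk⟩ := hn
      refine ⟨(leaf S h x k)[n], fun j hj => ?_⟩
      rcases le_total j k with hjk | hjk
      · exact (isRefining_leaf.isPrefix hjk).getElem hj
      · exact ((isRefining_leaf.isPrefix hjk).getElem hk).symm
    · push Not at hn
      exact ⟨0, fun k hk => absurd hk (hn k).not_gt⟩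
  choose ω hω using hω
  have h0 : ω 0 = 0 := by
    rw [← hω 0 0 (by simp [leaf])]
    simp [leaf]
  refine (Nat.frequently_atTop_iff_infinite.2 (hS ω h0 i)).mono ?_
  rintro k ⟨hs, m, hm⟩
  refine ⟨hs, ?_⟩
  have hl : leaf S h x k = List.ofFn (fun j : Fin (leaf S h x k).length => ω j) := by
    refine List.ext_getElem (by simp) fun n h1 h2 => ?_
    rw [List.getElem_ofFn, hω n k h1]
  have hpre : ∀ {p q : ℕ}, p ≤ q →
      List.ofFn (fun j : Fin p => ω j) <+: List.ofFn (fun j : Fin q => ω j) := by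
    intro p q hpq
    rw [List.prefix_iff_getElem]
    refine ⟨by simpa using hpq, fun n hn => by simp⟩
  -- Both words are initial segments of `ω`, hence comparable; two comparable current words are
  -- equal.
  rcases le_total m (leaf S h x k).length with hle | hle
  · exact leaves_prefix_free S.b_mem k _ (S.b_mem k) _ (leaf_mem k) (by
      rw [hm, hl]; exact hpre (by simpa using hle))
  · exact (leaves_prefix_free S.b_mem k _ (leaf_mem k) _ (S.b_mem k) (by
      rw [hm, hl]; exact hpre (by simpa using hle))).symm

end NoCollision

namespace NoCollision
variable {d : ℕ} {S : SlicingSchedule d} {h h' : ℕ → ℝ}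

/-! ### Masses of the pieces and the law of `ell` -/

section Mass
variable {μ ν : Measure (E d)} [IsProbabilityMeasure μ] [IsProbabilityMeasure ν]

/-- Conditioning on a null set gives the zero measure, so the value 1/2 by itself forces `A` to have
positive mass. -/
lemma measure_inter_of_cond_eq {Ω : Type*} [MeasurableSpace Ω] {μ : Measure Ω} [IsFiniteMeasure μ]
    {A B : Set Ω} (hA : MeasurableSet A)
    (hc : ProbabilityTheory.cond μ A B = 1 / 2) : μ (A ∩ B) = μ A / 2 ∧ μ A ≠ 0 := by
  rw [ProbabilityTheory.cond_apply hA] at hc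
  have h0 : μ A ≠ 0 := by
    intro h0
    rw [measure_mono_null inter_subset_left h0, mul_zero] at hc
    exact ENNReal.inv_ne_zero.2 ENNReal.ofNat_ne_top (hc.trans (one_div _)).symm
  refine ⟨?_, h0⟩
  rw [← one_mul (μ (A ∩ B)), ← ENNReal.mul_inv_cancel h0 (measure_ne_top μ A), mul_assoc, hc,
    one_div, ENNReal.div_eq_inv_mul, mul_comm]

lemma IsSlicing.measure_cell_concat (hμ : IsSlicing S μ h) (k : ℕ) (a : Fin 2) :
    μ (cell S h (k + 1) (S.b k ++ [a])) = μ (cell S h k (S.b k)) / 2 := by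
  fin_cases a
  · refine Eq.trans ?_ (measure_inter_of_cond_eq (measurableSet_cell k _) (hμ k).1).1
    rw [inter_comm]
    exact congrArg μ (cell_succ_zero k)
  · refine Eq.trans ?_ (measure_inter_of_cond_eq (measurableSet_cell k _) (hμ k).2).1
    rw [inter_comm]
    exact congrArg μ (cell_succ_one k)

lemma IsSlicing.measure_cell_ne_zero (hμ : IsSlicing S μ h) (k : ℕ) :
    ∀ w ∈ leaves S.b k, μ (cell S h k w) ≠ 0 := by
  induction k with
  | zero => intro w hw; simp_all [leaves, cell]
  | succ k ih =>
    intro w hw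
    rcases mem_leaves_succ.1 hw with ⟨_, hw'⟩ | ⟨a, rfl⟩
    · rw [cell_succ_of_mem hw']; exact ih w hw'
    · rw [hμ.measure_cell_concat]
      exact ENNReal.div_ne_zero.2 ⟨ih _ (S.b_mem k), by simp⟩

lemma IsSlicing.measure_cell_eq (hμ : IsSlicing S μ h) (hν : IsSlicing S ν h') (k : ℕ) :
    ∀ w ∈ leaves S.b k, μ (cell S h k w) = ν (cell S h' k w) := by
  induction k with
  | zero => intro w hw; simp_all [leaves, cell]
  | succ k ih =>
    intro w hw
    rcases mem_leaves_succ.1 hw with ⟨_, hw'⟩ | ⟨a, rfl⟩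
    · rw [cell_succ_of_mem hw', cell_succ_of_mem hw']; exact ih w hw'
    · rw [hμ.measure_cell_concat, hν.measure_cell_concat, ih _ (S.b_mem k)]

lemma comp_ellStep_eq_sum {F : Type*} [AddCommMonoid F] (g : ℝ → F) (k : ℕ) (x : E d) :
    g (ellStep S h k x) =
      ∑ w ∈ leaves S.b k, (cell S h k w).indicator (fun _ => g (code w)) x := by
  rw [ellStep_eq, Finset.sum_eq_single (leaf S h x k)]
  · rw [indicator_of_mem ((mem_cell_iff (leaf_mem k)).2 rfl)]
  · intro w hw hne
    rw [indicator_of_notMem]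
    exact fun hx => hne ((mem_cell_iff hw).1 hx).symm
  · exact fun hn => absurd (leaf_mem k) hn

lemma integral_comp_ellStep (g : ℝ → ℝ) (k : ℕ) :
    ∫ x, g (ellStep S h k x) ∂μ = ∑ w ∈ leaves S.b k, μ.real (cell S h k w) * g (code w) := by
  simp_rw [comp_ellStep_eq_sum g]
  rw [integral_finsetSum]
  · refine Finset.sum_congr rfl fun w _ => ?_
    rw [integral_indicator_const _ (measurableSet_cell k w), smul_eq_mul]
  · exact fun w _ => (integrable_const _).indicator (measurableSet_cell k w)

/-- The law of `ell` does not depend on the measure. -/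
lemma IsSlicing.map_ell_eq (hμ : IsSlicing S μ h) (hν : IsSlicing S ν h') :
    μ.map (ell S h) = ν.map (ell S h') := by
  have := Measure.isProbabilityMeasure_map (μ := μ) (measurable_ell (S := S) (h := h)).aemeasurable
  have := Measure.isProbabilityMeasure_map (μ := ν) (measurable_ell (S := S) (h := h')).aemeasurable
  refine ext_of_forall_integral_eq_of_IsFiniteMeasure fun g => ?_
  rw [integral_map measurable_ell.aemeasurable (by fun_prop),
    integral_map measurable_ell.aemeasurable (by fun_prop)]
  -- Bounded continuous test functions determine the law. At finite stages their integrals involve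
  -- only the masses of the pieces, and dominated convergence passes to the limit.
  have key : ∀ (μ : Measure (E d)) [IsProbabilityMeasure μ] (h : ℕ → ℝ),
      Tendsto (fun k => ∫ x, g (ellStep S h k x) ∂μ) atTop (𝓝 (∫ x, g (ell S h x) ∂μ)) := by
    intro μ _ h
    refine tendsto_integral_of_dominated_convergence (fun _ => ‖g‖) (fun k => ?_)
      (integrable_const _) (fun k => ae_of_all _ fun x => g.norm_coe_le_norm _)
      (ae_of_all _ fun x => (g.continuous.tendsto _).comp tendsto_ellStep)
    exact (g.continuous.measurable.comp (measurable_ellStep k)).aestronglyMeasurable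
  refine tendsto_nhds_unique (key μ h) ((key ν h').congr fun k => ?_)
  rw [integral_comp_ellStep, integral_comp_ellStep]
  refine Finset.sum_congr rfl fun w hw => ?_
  rw [measureReal_def, measureReal_def, hμ.measure_cell_eq hν k w hw]

end Mass

/-! ### Inverting an almost injective function -/

/-- By Lusin–Souslin, a Borel function injective on a Borel set is an embedding there with Borel
image, so its inverse extends measurably. The last clause concerns almost every value `r`, so it can
be transferred to any other measure with the same image law. -/
lemma exists_measurable_inverse {Y : Type*} [MeasurableSpace Y] [StandardBorelSpace Y] [Nonempty Y]
    {ν : Measure Y} {b : Y → ℝ} (hb : Measurable b) {P : Set Y}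
    (hP : ∀ᵐ y ∂ν, y ∈ P ∧ ∀ y' ∈ P, b y' = b y → y' = y) :
    ∃ g : ℝ → Y, Measurable g ∧ (∀ᵐ y ∂ν, g (b y) = y) ∧
      ∀ᵐ r ∂(ν.map b), b (g r) = r ∧ g r ∈ P ∧ ∀ y' ∈ P, b y' = r → y' = g r := by
  -- `P` is not assumed measurable; enlarging the exceptional set to a measurable null set makes its
  -- complement standard Borel.
  obtain ⟨N, hN, hNm, hN0⟩ := exists_measurable_superset_of_null (ae_iff.1 hP)
  have hM : ∀ y ∈ Nᶜ, y ∈ P ∧ ∀ y' ∈ P, b y' = b y → y' = y := by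
    intro y hy
    by_contra hc
    exact hy (hN hc)
  have hinj : InjOn b Nᶜ := fun y hy z hz hyz => (hM z hz).2 y (hM y hy).1 hyz
  have hemb : MeasurableEmbedding (Nᶜ.domRestrict b) := by
    have := hNm.compl.standardBorel
    exact (hb.comp measurable_subtype_coe).measurableEmbedding (injOn_iff_injective.1 hinj)
  obtain ⟨g, hg, hgb⟩ := hemb.exists_measurable_extend measurable_subtype_coe
    fun _ => (inferInstance : Nonempty Y)
  have hgb' : ∀ y ∈ Nᶜ, g (b y) = y := fun y hy => congrFun hgb ⟨y, hy⟩
  have hae : ∀ᵐ y ∂ν, y ∈ Nᶜ := compl_mem_ae_iff.2 hN0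
  refine ⟨g, hg, hae.mono hgb', ?_⟩
  have hA : MeasurableSet (b '' Nᶜ) := hNm.compl.image_of_measurable_injOn hb hinj
  have hAae : ∀ᵐ r ∂(ν.map b), r ∈ b '' Nᶜ :=
    (ae_map_iff hb.aemeasurable hA).2 (hae.mono fun y hy => mem_image_of_mem b hy)
  filter_upwards [hAae]
  rintro _ ⟨y, hy, rfl⟩
  rw [hgb' y hy]
  exact ⟨rfl, hM y hy⟩

end NoCollision

namespace NoCollision
variable {d : ℕ} {S : SlicingSchedule d} {h : ℕ → ℝ}

/-! ### The density of a measure along the pieces is a martingale -/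

lemma preimage_leaf (k : ℕ) (T : Set Word) :
    (fun x => leaf S h x k) ⁻¹' T = ⋃ w ∈ {w | w ∈ leaves S.b k ∧ w ∈ T}, cell S h k w := by
  ext x
  simp only [mem_preimage, mem_iUnion, mem_ofPred_eq, exists_prop]
  constructor
  · exact fun hx => ⟨_, ⟨leaf_mem k, hx⟩, (mem_cell_iff (leaf_mem k)).2 rfl⟩
  · rintro ⟨w, ⟨hw, hT⟩, hx⟩
    rwa [(mem_cell_iff hw).1 hx]

lemma measurableSet_preimage_leaf (k : ℕ) (T : Set Word) :
    MeasurableSet ((fun x => leaf S h x k) ⁻¹' T) := by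
  rw [preimage_leaf]
  refine MeasurableSet.biUnion (Set.Finite.countable ?_) fun w _ => measurableSet_cell k w
  exact (leaves S.b k).finite_toSet.subset fun w hw => hw.1

/-- The filtration generated by the partitions. -/
noncomputable def leafFiltration (S : SlicingSchedule d) (h : ℕ → ℝ) :
    Filtration ℕ (inferInstance : MeasurableSpace (E d)) where
  seq k := MeasurableSpace.comap (fun x => leaf S h x k) ⊤
  mono' := by
    refine monotone_nat_of_le_succ fun k => ?_
    rintro _ ⟨T, -, rfl⟩
    refine ⟨parent S k ⁻¹' T, trivial, ?_⟩
    ext x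
    simp [parent_leaf_succ]
  le' k := by
    rintro _ ⟨T, -, rfl⟩
    exact measurableSet_preimage_leaf k T

/-- The ratio of the masses that `V` and `ν` give to the piece containing `x`. -/
noncomputable def massRatio (S : SlicingSchedule d) (h : ℕ → ℝ) (V ν : Measure (E d)) (k : ℕ)
    (x : E d) : ℝ :=
  V.real (cell S h k (leaf S h x k)) / ν.real (cell S h k (leaf S h x k))

variable {V ν : Measure (E d)}

lemma massRatio_nonneg (k : ℕ) (x : E d) : 0 ≤ massRatio S h V ν k x :=
  div_nonneg measureReal_nonneg measureReal_nonneg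

lemma massRatio_eq_sum (k : ℕ) (x : E d) :
    massRatio S h V ν k x = ∑ w ∈ leaves S.b k, (cell S h k w).indicator
      (fun _ => V.real (cell S h k w) / ν.real (cell S h k w)) x := by
  rw [massRatio, Finset.sum_eq_single (leaf S h x k)]
  · rw [indicator_of_mem ((mem_cell_iff (leaf_mem k)).2 rfl)]
  · intro w hw hne
    rw [indicator_of_notMem]
    exact fun hx => hne ((mem_cell_iff hw).1 hx).symm
  · exact fun hn => absurd (leaf_mem k) hn

variable [IsProbabilityMeasure ν]

lemma integrable_massRatio (k : ℕ) : Integrable (massRatio S h V ν k) ν := by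
  rw [funext (massRatio_eq_sum k)]
  exact integrable_finsetSum _ fun w _ =>
    (integrable_const _).indicator (measurableSet_cell k w)

variable [IsFiniteMeasure V]

/-- On the σ-algebra of stage `k` the ratio is the density of `V` with respect to `ν`. There is no
singular part because every current piece has positive `ν`-mass. -/
lemma setIntegral_massRatio (hν : IsSlicing S ν h) (k : ℕ) (T : Set Word) :
    ∫ x in (fun x => leaf S h x k) ⁻¹' T, massRatio S h V ν k x ∂ν =
      V.real ((fun x => leaf S h x k) ⁻¹' T) := by
  classical
  have hF : {w | w ∈ leaves S.b k ∧ w ∈ T} = ((leaves S.b k).filter (· ∈ T) : Finset Word) := by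
    ext; simp
  have hdisj : ((leaves S.b k).filter (· ∈ T) : Set Word).PairwiseDisjoint (cell S h k) := by
    intro u hu v hv huv
    refine Set.disjoint_left.2 fun x hx hx' => huv ?_
    simp only [Finset.coe_filter, mem_ofPred_eq] at hu hv
    rw [← (mem_cell_iff hu.1).1 hx, ← (mem_cell_iff hv.1).1 hx']
  rw [preimage_leaf, hF]
  simp only [Finset.mem_coe]
  rw [integral_biUnion_finset _ (fun w _ => measurableSet_cell k w) hdisj
      (fun w _ => (integrable_massRatio k).integrableOn),
    measureReal_biUnion_finset hdisj (fun w _ => measurableSet_cell k w)]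
  refine Finset.sum_congr rfl fun w hw => ?_
  have hw' := (Finset.mem_filter.1 hw).1
  rw [setIntegral_congr_fun (g := fun _ => V.real (cell S h k w) / ν.real (cell S h k w))
    (measurableSet_cell k w), setIntegral_const, smul_eq_mul, mul_div_cancel₀]
  · rw [measureReal_def]
    exact (ENNReal.toReal_pos (hν.measure_cell_ne_zero k w hw') (measure_ne_top _ _)).ne'
  · intro x hx
    simp only [massRatio, (mem_cell_iff hw').1 hx]

lemma martingale_massRatio (hν : IsSlicing S ν h) :
    Martingale (massRatio S h V ν) (leafFiltration S h) ν := by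
  have hadp : StronglyAdapted (leafFiltration S h) (massRatio S h V ν) := by
    intro k
    refine Measurable.stronglyMeasurable ?_
    have : Measurable[⊤] fun w : Word => V.real (cell S h k w) / ν.real (cell S h k w) :=
      measurable_from_top
    exact this.comp (comap_measurable _)
  refine martingale_nat hadp integrable_massRatio fun k => ?_
  refine ae_eq_condExp_of_forall_setIntegral_eq ((leafFiltration S h).le k)
    (integrable_massRatio _) (fun s _ _ => (integrable_massRatio k).integrableOn) ?_
    (hadp k).aestronglyMeasurable
  rintro _ ⟨T, -, rfl⟩ -
  rw [setIntegral_massRatio hν]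
  -- An event of stage `k` is also one of stage `k + 1`, through `parent`; both integrals over it
  -- equal its `V`-mass.
  have : (fun x => leaf S h x k) ⁻¹' T = (fun x => leaf S h x (k + 1)) ⁻¹' (parent S k ⁻¹' T) := by
    ext x
    simp [parent_leaf_succ]
  rw [this, setIntegral_massRatio hν]

/-- Doob's convergence theorem: the ratio is nonnegative with integral `V univ` at every stage, so
the martingale is bounded in L¹. -/
lemma ae_tendsto_massRatio (hν : IsSlicing S ν h) :
    ∀ᵐ x ∂ν, ∃ l, Tendsto (fun k => massRatio S h V ν k x) atTop (𝓝 l) := by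
  have hb : ∀ k, eLpNorm (massRatio S h V ν k) 1 ν ≤ (V.real univ).toNNReal := by
    intro k
    rw [eLpNorm_one_eq_lintegral_enorm]
    simp_rw [fun x => Real.enorm_of_nonneg
      (massRatio_nonneg (S := S) (h := h) (V := V) (ν := ν) k x)]
    rw [← ofReal_integral_eq_lintegral_ofReal (integrable_massRatio k)
      (ae_of_all _ fun x => massRatio_nonneg k x)]
    have := setIntegral_massRatio (V := V) hν k univ
    rw [preimage_univ, setIntegral_univ] at this
    rw [this]
    exact le_rfl
  exact (martingale_massRatio hν).submartingale.exists_ae_tendsto_of_bdd hb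

/-! ### The pieces are boxes in the dual coordinates -/

section Box
variable (e : Module.Basis (Fin d) ℝ (E d))

/-- The coordinates `x ↦ (x · e i)_i`. -/
noncomputable def dualCoord : E d ≃L[ℝ] (Fin d → ℝ) :=
  (LinearEquiv.ofInjectiveOfFinrankEq
    (LinearMap.pi fun i => (innerₛₗ ℝ (e i) : E d →ₗ[ℝ] ℝ))
    (by
      rw [injective_iff_map_eq_zero]
      intro x hx
      refine InnerProductSpace.ext_inner_left_basis e fun i => ?_
      simpa using congrFun hx i)
    (by simp)).toContinuousLinearEquiv

lemma dualCoord_apply (x : E d) (i : Fin d) : dualCoord e x i = inner ℝ x (e i) :=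
  real_inner_comm x (e i)

open Classical in
/-- The range of `x · e i` on the piece with index `w`. -/
noncomputable def side (S : SlicingSchedule d) (h : ℕ → ℝ) (i : Fin d) : ℕ → Word → Set ℝ
  | 0, _ => univ
  | k + 1, w =>
      if w = S.b k ++ [0] then (if S.s k = e i then Iic (h k) else univ) ∩ side S h i k (S.b k)
      else if w = S.b k ++ [1] then
        (if S.s k = e i then Ioi (h k) else univ) ∩ side S h i k (S.b k)
      else side S h i k w

variable {e}

lemma side_succ_of_mem {i : Fin d} {k : ℕ} {w : Word} (hw : w ∈ leaves S.b k) :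
    side e S h i (k + 1) w = side e S h i k w := by
  rw [side, if_neg, if_neg] <;> rintro rfl <;> exact concat_notMem_leaves S.b_mem k _ hw

lemma side_concat_subset {i : Fin d} {k : ℕ} (a : Fin 2) :
    side e S h i (k + 1) (S.b k ++ [a]) ⊆ side e S h i k (S.b k) := by
  fin_cases a <;> simp [side]

lemma side_concat_of_ne {i : Fin d} {k : ℕ} (a : Fin 2) (hi : S.s k ≠ e i) :
    side e S h i (k + 1) (S.b k ++ [a]) = side e S h i k (S.b k) := by
  fin_cases a <;> simp [side, hi]

lemma measurableSet_side (i : Fin d) (k : ℕ) : ∀ w, MeasurableSet (side e S h i k w) := by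
  induction k with
  | zero => intro w; exact MeasurableSet.univ
  | succ k ih =>
    intro w
    rw [side]
    split_ifs <;> first
      | exact ih _ | exact MeasurableSet.univ.inter (ih _)
      | exact measurableSet_Iic.inter (ih _) | exact measurableSet_Ioi.inter (ih _)

lemma ordConnected_side (i : Fin d) (k : ℕ) : ∀ w, (side e S h i k w).OrdConnected := by
  induction k with
  | zero => intro w; exact ordConnected_univ
  | succ k ih =>
    intro w
    rw [side]
    split_ifs <;> first
      | exact ih _ | exact ordConnected_univ.inter (ih _)
      | exact ordConnected_Iic.inter (ih _) | exact ordConnected_Ioi.inter (ih _)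

/-- Each cut constrains a single dual coordinate, so it preserves the product form. -/
lemma cell_eq_box (hS : ∀ k, S.s k ∈ range e) (k : ℕ) : ∀ w ∈ leaves S.b k,
    cell S h k w = dualCoord e ⁻¹' pi univ fun i => side e S h i k w := by
  induction k with
  | zero => intro w hw; ext x; simp_all [leaves, cell, side]
  | succ k ih =>
    intro w hw
    rcases mem_leaves_succ.1 hw with ⟨_, hw'⟩ | ⟨a, rfl⟩
    · simp only [cell_succ_of_mem hw', side_succ_of_mem hw', ih w hw']
    · obtain ⟨j, hj⟩ := hS k
      have hij : ∀ i, S.s k = e i ↔ j = i := fun i => by rw [← hj]; exact e.injective.eq_iff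
      fin_cases a
      · refine (cell_succ_zero k).trans ?_
        rw [ih _ (S.b_mem k)]
        ext x
        simp only [Fin.zero_eta, side, if_true, hij, mem_inter_iff, mem_preimage, Set.mem_pi,
          mem_univ, forall_const, forall_and, dualCoord_apply, mem_ofPred_eq]
        refine and_congr_left fun _ => ?_
        constructor
        · intro hx i
          split_ifs with hi
          · subst hi; rw [hj]; exact hx
          · trivial
        · intro hx
          have := hx j
          rwa [if_pos rfl, hj] at this
      · refine (cell_succ_one k).trans ?_
        rw [ih _ (S.b_mem k)]
        ext x
        simp only [Fin.mk_one, side, List.append_cancel_left_eq, List.cons.injEq, and_true,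
          one_ne_zero, if_false, if_true, hij, mem_inter_iff,
          mem_preimage, Set.mem_pi, mem_univ, forall_const, forall_and, dualCoord_apply, mem_ofPred_eq]
        refine and_congr_left fun _ => ?_
        constructor
        · intro hx i
          split_ifs with hi
          · subst hi; rw [hj]; exact hx
          · trivial
        · intro hx
          have := hx j
          rwa [if_pos rfl, hj] at this

variable (e)

/-- The image of Lebesgue measure on `[-R, R]^d` under the inverse of `dualCoord e`. -/
noncomputable def boxMeasure (R : ℝ) : Measure (E d) :=
  (volume.restrict (pi univ fun _ : Fin d => Icc (-R) R)).map (dualCoord e).symm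

instance (R : ℝ) : IsFiniteMeasure (boxMeasure e R) := by
  have : IsFiniteMeasure (volume.restrict (pi univ fun _ : Fin d => Icc (-R) R)) :=
    ⟨by
      rw [Measure.restrict_apply_univ]
      exact (isCompact_univ_pi fun _ => isCompact_Icc).measure_lt_top⟩
  unfold boxMeasure
  infer_instance

/-- The length of the part in `[-R, R]` of the range of `x · e i` on a piece. -/
noncomputable def width (S : SlicingSchedule d) (h : ℕ → ℝ) (R : ℝ) (i : Fin d) (k : ℕ)
    (x : E d) : ℝ :=
  volume.real (side e S h i k (leaf S h x k) ∩ Icc (-R) R)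

variable {e} {R : ℝ} {x : E d}

lemma boxMeasure_real_cell (hS : ∀ k, S.s k ∈ range e) (k : ℕ) (x : E d) :
    (boxMeasure e R).real (cell S h k (leaf S h x k)) = ∏ i, width e S h R i k x := by
  have hpi : MeasurableSet (pi univ fun i => side e S h i k (leaf S h x k)) :=
    MeasurableSet.univ_pi fun i => measurableSet_side i k _
  have hm : Measurable (dualCoord e).symm := (dualCoord e).symm.continuous.measurable
  rw [measureReal_def, boxMeasure, Measure.map_apply hm (measurableSet_cell k _),
    cell_eq_box hS k _ (leaf_mem k), ← preimage_comp]
  simp only [ContinuousLinearEquiv.self_comp_symm, preimage_id]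
  rw [Measure.restrict_apply hpi, ← pi_inter_distrib, volume_pi_pi, ENNReal.toReal_prod]
  rfl

lemma side_leaf_succ_subset (i : Fin d) (k : ℕ) :
    side e S h i (k + 1) (leaf S h x (k + 1)) ⊆ side e S h i k (leaf S h x k) := by
  by_cases hk : leaf S h x k = S.b k
  · obtain ⟨a, ha⟩ := exists_leaf_succ_of_eq hk
    rw [ha, hk]
    exact side_concat_subset a
  · rw [leaf_succ_of_ne hk, side_succ_of_mem (leaf_mem k)]

lemma volume_inter_Icc_ne_top {A : Set ℝ} {a b : ℝ} : volume (A ∩ Icc a b) ≠ ∞ :=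
  measure_ne_top_of_subset inter_subset_right (by simp)

lemma antitone_width (i : Fin d) : Antitone fun k => width e S h R i k x :=
  antitone_nat_of_succ_le fun k => measureReal_mono
    (inter_subset_inter_left _ (side_leaf_succ_subset i k)) volume_inter_Icc_ne_top

/-- The cut changes only the `i`-th factor of the product of widths. The cross-multiplied form
avoids dividing by a width that could vanish. -/
lemma boxMeasure_mul_width (hS : ∀ k, S.s k ∈ range e) {k : ℕ} {i : Fin d} (hi : S.s k = e i)
    (hk : S.b k = leaf S h x k) :
    (boxMeasure e R).real (cell S h (k + 1) (leaf S h x (k + 1))) * width e S h R i k x =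
      (boxMeasure e R).real (cell S h k (leaf S h x k)) * width e S h R i (k + 1) x := by
  have hj : ∀ j ∈ Finset.univ.erase i, width e S h R j (k + 1) x = width e S h R j k x := by
    intro j hj
    obtain ⟨a, ha⟩ := exists_leaf_succ_of_eq hk.symm
    rw [width, width, ha, ← hk, side_concat_of_ne]
    rw [hi]
    exact fun hij => (Finset.ne_of_mem_erase hj) (e.injective hij).symm
  rw [boxMeasure_real_cell hS, boxMeasure_real_cell hS,
    ← Finset.mul_prod_erase _ _ (Finset.mem_univ i),
    ← Finset.mul_prod_erase _ (fun j => width e S h R j k x) (Finset.mem_univ i),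
    Finset.prod_congr rfl hj]
  ring

lemma ae_tendsto_width
    (hS : ∀ k, S.s k ∈ range e) (hω : ∀ ω : ℕ → Fin 2, ω 0 = 0 → ∀ i : Fin d,
      {k : ℕ | S.s k = e i ∧ ∃ m : ℕ, S.b k = List.ofFn (fun j : Fin m => ω j)}.Infinite)
    (hν : IsSlicing S ν h) {c : ℝ} (hc : 0 < c)
    (hle : ∀ A, c * ν.real A ≤ (boxMeasure e R).real A) :
    ∀ᵐ x ∂ν, ∀ i, Tendsto (fun k => width e S h R i k x) atTop (𝓝 0) := by
  filter_upwards [ae_tendsto_massRatio (V := boxMeasure e R) hν] with x hx i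
  obtain ⟨l, hl⟩ := hx
  have hpos : ∀ k, 0 < ν.real (cell S h k (leaf S h x k)) := fun k =>
    ENNReal.toReal_pos (hν.measure_cell_ne_zero k _ (leaf_mem k)) (measure_ne_top _ _)
  -- This is where domination of `ν` by the box measure enters: it keeps the limit of the ratios
  -- away from 0.
  have hcl : c ≤ l := ge_of_tendsto' hl fun k => (le_div_iff₀ (hpos k)).2 (hle _)
  have hu := tendsto_atTop_ciInf (antitone_width (e := e) (S := S) (h := h) (R := R) (x := x) i)
    ⟨0, by rintro _ ⟨k, rfl⟩; exact measureReal_nonneg⟩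
  generalize (⨅ k, width e S h R i k x) = u at hu
  have h1 := (hl.comp (tendsto_add_atTop_nat 1)).mul hu
  have h2 := (hl.mul (hu.comp (tendsto_add_atTop_nat 1))).const_mul 2
  have hfreq : ∃ᶠ k in atTop, massRatio S h (boxMeasure e R) ν (k + 1) x * width e S h R i k x =
      2 * (massRatio S h (boxMeasure e R) ν k x * width e S h R i (k + 1) x) := by
    refine (frequently_cut (h := h) hω x i).mono ?_
    rintro k ⟨hi, hk⟩
    have hhalf : ν.real (cell S h (k + 1) (leaf S h x (k + 1))) =
        ν.real (cell S h k (leaf S h x k)) / 2 := by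
      obtain ⟨a, ha⟩ := exists_leaf_succ_of_eq hk.symm
      rw [ha, ← hk, measureReal_def, hν.measure_cell_concat, ENNReal.toReal_div]
      rfl
    have hV := boxMeasure_mul_width (R := R) hS hi hk
    have hp := (hpos k).ne'
    rw [massRatio, massRatio, hhalf]
    field_simp
    linear_combination hV
  -- Both sides of `hfreq` converge, and equality along infinitely many `k` is enough to equate the
  -- limits.
  have h12 : l * u = 2 * (l * u) := by
    have := isClosed_eq (continuous_fst (X := ℝ) (Y := ℝ)) continuous_snd
    exact this.mem_of_frequently_of_tendsto hfreq (h1.prodMk_nhds h2)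
  have hu0 : u = 0 := by
    have : l * u = 0 := by linarith
    rcases mul_eq_zero.1 this with h | h
    · linarith
    · exact h
  exact hu0 ▸ hu

/-- Sides are order-connected, so the whole interval between the `i`-th coordinates of the two
points lies in the side, and its length is at most the width. -/
lemma eq_of_tendsto_width {y : E d} (hx : ∀ i, dualCoord e x i ∈ Icc (-R) R)
    (hy : ∀ i, dualCoord e y i ∈ Icc (-R) R) (hS : ∀ k, S.s k ∈ range e)
    (hw : ∀ i, Tendsto (fun k => width e S h R i k x) atTop (𝓝 0))
    (hl : ∀ k, leaf S h y k = leaf S h x k) : y = x := by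
  refine (dualCoord e).injective (funext fun i => ?_)
  have hmem : ∀ k, dualCoord e x i ∈ side e S h i k (leaf S h x k) ∧
      dualCoord e y i ∈ side e S h i k (leaf S h x k) := by
    intro k
    have h1 := (mem_cell_iff (S := S) (x := x) (h := h) (leaf_mem k)).2 rfl
    have h2 := (mem_cell_iff (S := S) (x := y) (h := h) (leaf_mem k)).2 rfl
    rw [hl k] at h2
    rw [cell_eq_box hS k _ (leaf_mem k)] at h1 h2
    exact ⟨h1 i trivial, h2 i trivial⟩
  have hle : ∀ k, |dualCoord e x i - dualCoord e y i| ≤ width e S h R i k x := by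
    intro k
    have hs : uIcc (dualCoord e y i) (dualCoord e x i) ⊆
        side e S h i k (leaf S h x k) ∩ Icc (-R) R :=
      ((ordConnected_side i k _).inter ordConnected_Icc).uIcc_subset
        ⟨(hmem k).2, hy i⟩ ⟨(hmem k).1, hx i⟩
    have := measureReal_mono hs (μ := volume) volume_inter_Icc_ne_top
    rwa [measureReal_def, Real.volume_interval, ENNReal.toReal_ofReal (abs_nonneg _)] at this
  have h0 := ge_of_tendsto' (hw i) hle
  have := abs_nonpos_iff.1 h0
  linarith

end Box

end NoCollision

namespace NoCollision
variable {d : ℕ} {S : SlicingSchedule d} {h : ℕ → ℝ}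

/-! ### Measures of the class `calK` -/

lemma exists_le_smul_of_mem_calK {ν : Measure (E d)} (hν : ν ∈ calK d) :
    ∃ C : NNReal, ν ≤ C • volume := by
  obtain ⟨-, -, -, f, hf, hf0, rfl, c, C, hc, hC, hfC⟩ := hν
  refine ⟨C.toNNReal, ?_⟩
  -- The bound on `f` is known only `ν`-a.e., that is, at almost every point where the density is
  -- nonzero; elsewhere it is trivial.
  rw [ae_withDensity_iff (by fun_prop)] at hfC
  refine (withDensity_mono (g := fun _ => ENNReal.ofReal C) ?_).trans (withDensity_const _).le
  filter_upwards [hfC] with x hx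
  by_cases h0 : ENNReal.ofReal (f x) = 0
  · rw [h0]; exact zero_le
  · exact ENNReal.ofReal_le_ofReal (hx h0).2

lemma ae_mem_interior_support {ν : Measure (E d)} (hν : ν ∈ calK d) :
    ∀ᵐ y ∂ν, y ∈ interior ν.support := by
  filter_upwards [Measure.support_mem_ae (μ := ν), compl_mem_ae_iff.2 hν.2.2.1] with y hy hy'
  by_contra hc
  exact hy' ⟨subset_closure hy, hc⟩

/-- `ν` lives on its compact support, which fits in a box in the dual coordinates, and by uniqueness
of Haar measure `volume` is a multiple of Lebesgue measure transported from these coordinates. -/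
lemma exists_le_boxMeasure (e : Module.Basis (Fin d) ℝ (E d)) {ν : Measure (E d)}
    (hν : ν ∈ calK d) : ∃ R c : ℝ, 0 < c ∧
      (∀ y ∈ ν.support, ∀ i, dualCoord e y i ∈ Icc (-R) R) ∧
      ∀ A, c * ν.real A ≤ (boxMeasure e R).real A := by
  have := hν.1
  obtain ⟨C, hC⟩ := exists_le_smul_of_mem_calK hν
  obtain ⟨R, hR⟩ := (hν.2.1.image (dualCoord e).continuous).isBounded.subset_closedBall 0
  have hsupp : ∀ y ∈ ν.support, ∀ i, dualCoord e y i ∈ Icc (-R) R := by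
    intro y hy i
    have h1 : ‖dualCoord e y‖ ≤ R := by simpa using hR (mem_image_of_mem _ hy)
    exact abs_le.1 ((norm_le_pi_norm (dualCoord e y) i).trans h1)
  set m : Measure (E d) := (volume : Measure (Fin d → ℝ)).map (dualCoord e).symm with hm
  have hmH : m.IsAddHaarMeasure := (dualCoord e).symm.isAddHaarMeasure_map _
  obtain ⟨κ, hκ⟩ : ∃ κ : NNReal, (volume : Measure (E d)) = κ • m :=
    ⟨_, Measure.isAddLeftInvariant_eq_smul _ _⟩
  have hcont : Measurable (dualCoord e).symm := (dualCoord e).symm.continuous.measurable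
  have hle : ∀ A, ν A ≤ (C * κ : NNReal) * boxMeasure e R A := by
    intro A
    have hbox : MeasurableSet (pi univ fun _ : Fin d => Icc (-R) R) :=
      MeasurableSet.univ_pi fun _ => measurableSet_Icc
    have hemb : MeasurableEmbedding (dualCoord e).symm :=
      (dualCoord e).symm.toHomeomorph.measurableEmbedding
    calc ν A ≤ ν (A ∩ ν.support) :=
          (measure_inter_conull Measure.measure_compl_support).ge
      _ ≤ (C • volume) (A ∩ ν.support) := hC _
      _ = (C * κ : NNReal) * m (A ∩ ν.support) := by
          rw [hκ, smul_smul]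
          rfl
      _ ≤ _ := by
          refine mul_le_mul_right ?_ _
          rw [hm, hemb.map_apply, boxMeasure, hemb.map_apply, Measure.restrict_apply' hbox]
          refine measure_mono fun z hz => ⟨hz.1, fun i _ => ?_⟩
          simpa using hsupp _ hz.2 i
  -- The added 1 keeps the inverse positive without checking that `C * κ` is nonzero.
  refine ⟨R, ((C * κ : NNReal) + 1 : ℝ)⁻¹, by positivity, hsupp, fun A => ?_⟩
  rw [inv_mul_le_iff₀ (by positivity)]
  have h1 := ENNReal.toReal_mono (by finiteness) (hle A)
  rw [ENNReal.toReal_mul, ENNReal.coe_toReal] at h1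
  have h2 : 0 ≤ (boxMeasure e R).real A := measureReal_nonneg
  rw [measureReal_def] at h2 ⊢
  rw [measureReal_def]
  linarith

/-- Almost every point is determined, inside the interior of the support, by its limit code. -/
lemma IsSlicing.ae_eq_of_ell_eq (hS : S.Admissible) {ν : Measure (E d)} (hν : ν ∈ calK d)
    (hs : IsSlicing S ν h) :
    ∀ᵐ y ∂ν, y ∈ interior ν.support ∧
      ∀ y' ∈ interior ν.support, ell S h y' = ell S h y → y' = y := by
  obtain ⟨e, he, hω⟩ := hS
  have := hν.1
  obtain ⟨R, c, hc, hsupp, hle⟩ := exists_le_boxMeasure e hν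
  filter_upwards [ae_tendsto_width he hω hs hc hle, ae_mem_interior_support hν] with y hy hyi
  exact ⟨hyi, fun y' hy' hell => eq_of_tendsto_width (hsupp y (interior_subset hyi))
    (hsupp y' (interior_subset hy')) he hy (leaf_eq_of_ell_eq hell)⟩

/-! ### The uniform measure on the cube -/

lemma isCompact_cube : IsCompact {x : E d | ∀ i, x i ∈ Icc (0 : ℝ) 1} := by
  have : {x : E d | ∀ i, x i ∈ Icc (0 : ℝ) 1} =
      (EuclideanSpace.equiv (Fin d) ℝ).toHomeomorph ⁻¹' pi univ fun _ => Icc 0 1 := by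
    ext x; simp [Set.mem_pi, -pi_univ_Icc]
  rw [this, Homeomorph.isCompact_preimage]
  exact isCompact_univ_pi fun _ => isCompact_Icc

lemma convex_cube : Convex ℝ {x : E d | ∀ i, x i ∈ Icc (0 : ℝ) 1} := by
  intro x hx y hy a b ha hb hab i
  exact convex_Icc (0 : ℝ) 1 (hx i) (hy i) ha hb hab

lemma volume_cube : volume {x : E d | ∀ i, x i ∈ Icc (0 : ℝ) 1} = 1 := by
  have : {x : E d | ∀ i, x i ∈ Icc (0 : ℝ) 1} = WithLp.ofLp ⁻¹' pi univ fun _ => Icc 0 1 := by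
    ext x; simp [Set.mem_pi, -pi_univ_Icc]
  rw [this, (PiLp.volume_preserving_ofLp (Fin d)).measure_preimage
    (MeasurableSet.univ_pi fun _ => measurableSet_Icc).nullMeasurableSet, volume_pi_pi]
  simp

/-- The support lies between the interior of the cube and the cube, so its frontier lies in that of
a convex set, which is null. -/
lemma uniformCube_mem_calK : uniformCube d ∈ calK d := by
  have hK := isCompact_cube (d := d)
  have hsub : (uniformCube d).support ⊆ {x : E d | ∀ i, x i ∈ Icc (0 : ℝ) 1} :=
    Measure.support_subset_of_isClosed hK.isClosed (ae_restrict_mem hK.measurableSet)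
  have hint : interior {x : E d | ∀ i, x i ∈ Icc (0 : ℝ) 1} ⊆ (uniformCube d).support := by
    have := Measure.interior_inter_support (μ := (volume : Measure (E d)))
      (s := {x : E d | ∀ i, x i ∈ Icc (0 : ℝ) 1})
    rwa [Measure.support_eq_univ, inter_univ] at this
  refine ⟨⟨?_⟩, hK.of_isClosed_subset Measure.isClosed_support hsub, ?_,
    {x : E d | ∀ i, x i ∈ Icc (0 : ℝ) 1}.indicator 1, measurable_one.indicator hK.measurableSet,
    indicator_nonneg fun _ _ => zero_le_one, ?_, 1, 1, one_pos, one_pos, ?_⟩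
  · rw [uniformCube, Measure.restrict_apply_univ, volume_cube]
  · refine measure_mono_null (t := frontier {x : E d | ∀ i, x i ∈ Icc (0 : ℝ) 1}) ?_
      (Measure.restrict_le_self.absolutelyContinuous (convex_cube.addHaar_frontier volume))
    rw [Measure.isClosed_support.frontier_eq, hK.isClosed.frontier_eq]
    exact sdiff_subset_sdiff hsub (interior_maximal hint isOpen_interior)
  · rw [uniformCube, ← withDensity_indicator_one hK.measurableSet]
    congr 1
    ext x
    by_cases hx : x ∈ {x : E d | ∀ i, x i ∈ Icc (0 : ℝ) 1}
    · rw [indicator_of_mem hx, indicator_of_mem hx, Pi.one_apply, Pi.one_apply, ENNReal.ofReal_one]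
    · rw [indicator_of_notMem hx, indicator_of_notMem hx, ENNReal.ofReal_zero]
  · filter_upwards [ae_restrict_mem hK.measurableSet] with x hx
    have hx' : x ∈ {x : E d | ∀ i, x i ∈ Icc (0 : ℝ) 1} := hx
    rw [indicator_of_mem hx', Pi.one_apply]
    exact ⟨le_rfl, le_rfl⟩

/-! ### Existence of slicings -/

/-- Without atoms the distribution function is continuous, and the intermediate value theorem
applies. -/
lemma exists_measure_Iic_eq_half (ρ : Measure ℝ) [IsProbabilityMeasure ρ] [NullSingletonClass ρ] :
    ∃ t, ρ (Iic t) = 1 / 2 ∧ ρ (Ioi t) = 1 / 2 := by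
  have hcont : Continuous (ProbabilityTheory.cdf ρ) := by
    rw [continuous_iff_continuousAt]
    intro x
    rw [(ProbabilityTheory.monotone_cdf ρ).continuousAt_iff_leftLim_eq_rightLim,
      StieltjesFunction.rightLim_eq]
    have h0 := (ProbabilityTheory.cdf ρ).measure_singleton x
    rw [ProbabilityTheory.measure_cdf, measure_singleton, eq_comm, ENNReal.ofReal_eq_zero] at h0
    exact le_antisymm ((ProbabilityTheory.monotone_cdf ρ).leftLim_le le_rfl) (by linarith)
  obtain ⟨a, ha⟩ := ((ProbabilityTheory.tendsto_cdf_atBot ρ).eventually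
    (gt_mem_nhds (show (0 : ℝ) < 1 / 2 by norm_num))).exists
  obtain ⟨b, hb⟩ := ((ProbabilityTheory.tendsto_cdf_atTop ρ).eventually
    (lt_mem_nhds (show (1 / 2 : ℝ) < 1 by norm_num))).exists
  obtain ⟨t, ht⟩ := mem_range_of_exists_le_of_exists_ge hcont ⟨a, ha.le⟩ ⟨b, hb.le⟩
  have h1 : ρ (Iic t) = 1 / 2 := by
    rw [← ProbabilityTheory.ofReal_cdf, ht, ENNReal.ofReal_div_of_pos two_pos]
    simp
  refine ⟨t, h1, ?_⟩
  rw [← compl_Iic, prob_compl_eq_one_sub measurableSet_Iic, h1, one_div, ENNReal.one_sub_inv_two]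

lemma volume_hyperplane {s : E d} (hs : ‖s‖ = 1) (t : ℝ) :
    volume {x : E d | inner ℝ x s = t} = 0 := by
  have hss : inner ℝ s s = (1 : ℝ) := by rw [real_inner_self_eq_norm_sq, hs, one_pow]
  have hmem : ∀ x, x ∈ AffineSubspace.mk' (t • s) (LinearMap.ker (innerₛₗ ℝ s : E d →ₗ[ℝ] ℝ)) ↔
      inner ℝ x s = t := by
    intro x
    rw [AffineSubspace.mem_mk', vsub_eq_sub, LinearMap.mem_ker, innerₛₗ_apply_apply,
      inner_sub_right, inner_smul_right, hss, mul_one, sub_eq_zero, real_inner_comm]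
  have hset : {x : E d | inner ℝ x s = t} =
      AffineSubspace.mk' (t • s) (LinearMap.ker (innerₛₗ ℝ s : E d →ₗ[ℝ] ℝ)) := by
    ext x
    exact (hmem x).symm
  rw [hset]
  refine Measure.addHaar_affineSubspace _ _ fun htop => ?_
  have h1 := (hmem ((t + 1) • s)).1 (htop ▸ AffineSubspace.mem_top ℝ (E d) _)
  rw [inner_smul_left, hss] at h1
  simp at h1

lemma exists_cond_eq_half {μ : Measure (E d)} [IsFiniteMeasure μ] (hμ : μ ≪ volume) {s : E d}
    (hs : ‖s‖ = 1) {A : Set (E d)} (hA : μ A ≠ 0) :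
    ∃ t : ℝ, ProbabilityTheory.cond μ A {x | inner ℝ x s ≤ t} = 1 / 2 ∧
      ProbabilityTheory.cond μ A {x | t < inner ℝ x s} = 1 / 2 := by
  have := ProbabilityTheory.cond_isProbabilityMeasure hA
  have hm : Measurable fun x : E d => inner ℝ x s := by fun_prop
  set ρ := (ProbabilityTheory.cond μ A).map fun x => inner ℝ x s with hρ
  have : IsProbabilityMeasure ρ := Measure.isProbabilityMeasure_map hm.aemeasurable
  have : NullSingletonClass ρ := by
    refine ⟨fun t => ?_⟩
    rw [hρ, Measure.map_apply hm (measurableSet_singleton t)]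
    exact (ProbabilityTheory.cond_absolutelyContinuous.trans hμ) (volume_hyperplane hs t)
  obtain ⟨t, h1, h2⟩ := exists_measure_Iic_eq_half ρ
  rw [hρ, Measure.map_apply hm measurableSet_Iic] at h1
  rw [hρ, Measure.map_apply hm measurableSet_Ioi] at h2
  exact ⟨t, h1, h2⟩

/-- Pieces of stage `k` depend only on the first `k` thresholds, so thresholds can be chosen
recursively. -/
lemma cell_congr {h h' : ℕ → ℝ} {k : ℕ} (hh : ∀ j < k, h j = h' j) : cell S h k = cell S h' k := by
  induction k with
  | zero => ext w x; simp [cell]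
  | succ k ih =>
    have := ih fun j hj => hh j (hj.trans k.lt_succ_self)
    ext w x
    rw [cell, cell, this, hh k k.lt_succ_self]

open Classical in
/-- A number that halves the mass of `A` when `A` is cut in the direction `s`. -/
noncomputable def halvingThreshold (μ : Measure (E d)) (s : E d) (A : Set (E d)) : ℝ :=
  if ht : ∃ t : ℝ, ProbabilityTheory.cond μ A {x | inner ℝ x s ≤ t} = 1 / 2 ∧
      ProbabilityTheory.cond μ A {x | t < inner ℝ x s} = 1 / 2 then ht.choose else 0

/-- The first `k` thresholds of a slicing, continued arbitrarily. -/
noncomputable def partialSlicing (S : SlicingSchedule d) (μ : Measure (E d)) : ℕ → ℕ → ℝ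
  | 0 => 0
  | k + 1 => Function.update (partialSlicing S μ k) k
      (halvingThreshold μ (S.s k) (cell S (partialSlicing S μ k) k (S.b k)))

lemma partialSlicing_of_lt {μ : Measure (E d)} {j k : ℕ} (hjk : j < k) :
    partialSlicing S μ k j = partialSlicing S μ (j + 1) j := by
  induction k, hjk using Nat.le_induction with
  | base => rfl
  | succ k hk ih => rw [partialSlicing, Function.update_of_ne (by omega), ih]

lemma exists_isSlicing {μ : Measure (E d)} [IsProbabilityMeasure μ] (hμ : μ ≪ volume) :
    ∃ h, IsSlicing S μ h := by
  set h : ℕ → ℝ := fun k => partialSlicing S μ (k + 1) k with hh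
  have hcell : ∀ k, cell S (partialSlicing S μ k) k = cell S h k := fun k =>
    cell_congr fun j hj => partialSlicing_of_lt hj
  have hk : ∀ k, h k = halvingThreshold μ (S.s k) (cell S h k (S.b k)) := fun k => by
    rw [hh, ← hcell]
    simp only [partialSlicing, Function.update_self]
  have hstep : ∀ k, μ (cell S h k (S.b k)) ≠ 0 →
      ProbabilityTheory.cond μ (cell S h k (S.b k)) {x | inner ℝ x (S.s k) ≤ h k} = 1 / 2 ∧
      ProbabilityTheory.cond μ (cell S h k (S.b k)) {x | h k < inner ℝ x (S.s k)} = 1 / 2 := by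
    intro k h0
    have hex := exists_cond_eq_half hμ (S.norm_s k) h0
    have := hex.choose_spec
    rw [hk k, halvingThreshold, dif_pos hex]
    exact this
  -- A threshold is known to halve a piece only if that piece has positive mass, and halving passes
  -- positivity on to the children.
  have hpos : ∀ k, ∀ w ∈ leaves S.b k, μ (cell S h k w) ≠ 0 := by
    intro k
    induction k with
    | zero =>
      intro w hw
      rw [leaves, Finset.mem_singleton] at hw
      rw [cell, if_pos hw]
      exact IsProbabilityMeasure.ne_zero μ ∘ Measure.measure_univ_eq_zero.1
    | succ k ih =>
      intro w hw
      rcases mem_leaves_succ.1 hw with ⟨_, hw'⟩ | ⟨a, rfl⟩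
      · rw [cell_succ_of_mem hw']; exact ih w hw'
      · have h2 := hstep k (ih _ (S.b_mem k))
        have h3 := (measure_inter_of_cond_eq (measurableSet_cell k _) h2.1).1
        have h4 := (measure_inter_of_cond_eq (measurableSet_cell k _) h2.2).1
        have h5 : μ (cell S h k (S.b k)) / 2 ≠ 0 :=
          ENNReal.div_ne_zero.2 ⟨ih _ (S.b_mem k), by simp⟩
        fin_cases a
        · refine ne_of_eq_of_ne (congrArg μ (cell_succ_zero k)) ?_
          rwa [inter_comm, h3]
        · refine ne_of_eq_of_ne (congrArg μ (cell_succ_one k)) ?_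
          rwa [inter_comm, h4]
  exact ⟨h, fun k => hstep k (hpos k _ (S.b_mem k))⟩

end NoCollision

namespace NoCollision
variable {d : ℕ} {S : SlicingSchedule d} {h : Measure (E d) → ℕ → ℝ} {μ ν σ : Measure (E d)}

/-! ### The no-collision maps -/

lemma matches_tMap {x : E d} (hx : ∃! y, Matches S h μ ν x y) :
    Matches S h μ ν x (tMap S h μ ν x) := by
  rw [tMap, dif_pos hx]
  exact hx.choose_spec.1

/-- The map sees the source measure and point only through the code, and this includes the default
value 0. Hence composition needs no assumption on the final target. -/
lemma tMap_congr {x z : E d} (he : ell S (h μ) x = ell S (h σ) z) :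
    tMap S h μ ν x = tMap S h σ ν z := by
  have : Matches S h μ ν x = Matches S h σ ν z := by
    ext y
    rw [Matches, Matches, he]
  unfold tMap
  rw [this]

lemma exists_tMap_ae_eq (hS : S.Admissible) (hμ : μ ∈ calK d) (hν : ν ∈ calK d)
    (hsμ : IsSlicing S μ (h μ)) (hsν : IsSlicing S ν (h ν)) :
    ∃ g : ℝ → E d, Measurable g ∧ (∀ᵐ y ∂ν, g (ell S (h ν) y) = y) ∧
      ∀ᵐ x ∂μ, (∃! y, Matches S h μ ν x y) ∧ tMap S h μ ν x = g (ell S (h μ) x) := by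
  have := hμ.1
  have := hν.1
  obtain ⟨g, hg, hgν, hgr⟩ := exists_measurable_inverse measurable_ell (hsν.ae_eq_of_ell_eq hS hν)
  refine ⟨g, hg, hgν, ?_⟩
  -- The common law of the codes carries an almost-everywhere statement from `ν` to `μ`.
  rw [← hsμ.map_ell_eq hsν] at hgr
  filter_upwards [ae_of_ae_map measurable_ell.aemeasurable hgr] with x hx
  have hex : ∃! y, Matches S h μ ν x y :=
    ⟨_, ⟨hx.2.1, hx.1⟩, fun y hy => hx.2.2 y hy.1 hy.2⟩
  have ht := matches_tMap hex
  exact ⟨hex, hx.2.2 _ ht.1 ht.2⟩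

lemma ae_existsUnique_matches (hS : S.Admissible) (hμ : μ ∈ calK d) (hν : ν ∈ calK d)
    (hsμ : IsSlicing S μ (h μ)) (hsν : IsSlicing S ν (h ν)) :
    ∀ᵐ x ∂μ, ∃! y, Matches S h μ ν x y := by
  obtain ⟨_, -, -, hg⟩ := exists_tMap_ae_eq hS hμ hν hsμ hsν
  exact hg.mono fun _ hx => hx.1

lemma aemeasurable_tMap (hS : S.Admissible) (hμ : μ ∈ calK d) (hν : ν ∈ calK d)
    (hsμ : IsSlicing S μ (h μ)) (hsν : IsSlicing S ν (h ν)) :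
    AEMeasurable (tMap S h μ ν) μ := by
  obtain ⟨g, hg, -, hgμ⟩ := exists_tMap_ae_eq hS hμ hν hsμ hsν
  exact ⟨_, hg.comp measurable_ell, hgμ.mono fun _ hx => hx.2⟩

lemma map_tMap (hS : S.Admissible) (hμ : μ ∈ calK d) (hν : ν ∈ calK d)
    (hsμ : IsSlicing S μ (h μ)) (hsν : IsSlicing S ν (h ν)) :
    μ.map (tMap S h μ ν) = ν := by
  have := hμ.1
  have := hν.1
  obtain ⟨g, hg, hgν, hgμ⟩ := exists_tMap_ae_eq hS hμ hν hsμ hsν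
  calc μ.map (tMap S h μ ν) = μ.map (g ∘ ell S (h μ)) :=
        Measure.map_congr (hgμ.mono fun _ hx => hx.2)
    _ = (ν.map (ell S (h ν))).map g := by
        rw [← Measure.map_map hg measurable_ell, hsμ.map_ell_eq hsν]
    _ = ν.map id := by
        rw [Measure.map_map hg measurable_ell]
        exact Measure.map_congr hgν
    _ = ν := Measure.map_id

/-- No-collision maps compose. -/
lemma ae_tMap_tMap (hS : S.Admissible) (hσ : σ ∈ calK d) (hμ : μ ∈ calK d)
    (hsσ : IsSlicing S σ (h σ)) (hsμ : IsSlicing S μ (h μ)) (ν : Measure (E d)) :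
    ∀ᵐ z ∂σ, tMap S h μ ν (tMap S h σ μ z) = tMap S h σ ν z := by
  filter_upwards [ae_existsUnique_matches hS hσ hμ hsσ hsμ] with z hz
  exact tMap_congr (matches_tMap hz).2

lemma memLp_tMap (hS : S.Admissible) (hμ : μ ∈ calK d) (hν : ν ∈ calK d)
    (hsμ : IsSlicing S μ (h μ)) (hsν : IsSlicing S ν (h ν)) (p : ℝ≥0∞) :
    MemLp (tMap S h μ ν) p μ := by
  have := hμ.1
  obtain ⟨R, hR⟩ := hν.2.1.isBounded.exists_norm_le
  refine MemLp.of_bound (aemeasurable_tMap hS hμ hν hsμ hsν).aestronglyMeasurable R ?_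
  filter_upwards [ae_existsUnique_matches hS hμ hν hsμ hsν] with x hx
  exact hR _ (interior_subset (matches_tMap hx).1)

lemma memLp_id_of_mem_calK (hμ : μ ∈ calK d) (p : ℝ≥0∞) : MemLp (fun x : E d => x) p μ := by
  have := hμ.1
  obtain ⟨R, hR⟩ := hμ.2.1.isBounded.exists_norm_le
  refine MemLp.of_bound aestronglyMeasurable_id R ?_
  filter_upwards [Measure.support_mem_ae (μ := μ)] with x hx
  exact hR x hx

/-- The no-collision distance is the `L^p` distance of the no-collision maps from a fixed measure. -/
lemma W_eq_norm_sub (hS : S.Admissible) (hσ : σ ∈ calK d) (hμ : μ ∈ calK d) (hν : ν ∈ calK d)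
    (hsσ : IsSlicing S σ (h σ)) (hsμ : IsSlicing S μ (h μ)) (hsν : IsSlicing S ν (h ν)) {p : ℝ}
    (hp : 1 ≤ p) (h1 : MemLp (tMap S h σ ν) (ENNReal.ofReal p) σ)
    (h2 : MemLp (tMap S h σ μ) (ENNReal.ofReal p) σ) :
    W S h p μ ν = ‖h1.toLp - h2.toLp‖ := by
  have hp0 : ENNReal.ofReal p ≠ 0 := by
    rw [ne_eq, ENNReal.ofReal_eq_zero]; linarith
  have hpR : (ENNReal.ofReal p).toReal = p := ENNReal.toReal_ofReal (by linarith)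
  rw [← MemLp.toLp_sub, Lp.norm_toLp,
    (h1.sub h2).eLpNorm_eq_integral_rpow_norm hp0 ENNReal.ofReal_ne_top, hpR,
    ENNReal.toReal_ofReal (Real.rpow_nonneg (integral_nonneg fun _ => by positivity) _), W, one_div]
  congr 1
  have hmap := map_tMap hS hσ hμ hsσ hsμ
  have hm := aemeasurable_tMap hS hσ hμ hsσ hsμ
  have hint : AEStronglyMeasurable (fun x => ‖tMap S h μ ν x - x‖ ^ p)
      (σ.map (tMap S h σ μ)) := by
    rw [hmap]
    exact (((aemeasurable_tMap hS hμ hν hsμ hsν).sub aemeasurable_id).norm.pow_const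
      p).aestronglyMeasurable
  calc ∫ x, ‖tMap S h μ ν x - x‖ ^ p ∂μ
      = ∫ x, ‖tMap S h μ ν x - x‖ ^ p ∂(σ.map (tMap S h σ μ)) := by rw [hmap]
    _ = ∫ z, ‖tMap S h μ ν (tMap S h σ μ z) - tMap S h σ μ z‖ ^ p ∂σ := integral_map hm hint
    _ = ∫ z, ‖(tMap S h σ ν - tMap S h σ μ) z‖ ^ p ∂σ := by
        refine integral_congr_ae ?_
        filter_upwards [ae_tMap_tMap hS hσ hμ hsσ hsμ ν] with z hz
        simp only [hz, Pi.sub_apply]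

end NoCollision

theorem mainTheorem9 {d : ℕ} (S : NoCollision.SlicingSchedule d) (hS : S.Admissible) :
    -- every absolutely continuous probability measure can be sliced
    (∀ μ : Measure (NoCollision.E d), IsProbabilityMeasure μ → μ ≪ volume →
      ∃ h : ℕ → ℝ, NoCollision.IsSlicing S μ h) ∧
    -- whatever slicings are chosen, the following holds
    ∀ h : Measure (NoCollision.E d) → ℕ → ℝ,
      (∀ μ ∈ NoCollision.calK d, NoCollision.IsSlicing S μ (h μ)) →
      -- the no-collision maps are defined almost everywhere
      (∀ μ ∈ NoCollision.calK d, ∀ ν ∈ NoCollision.calK d,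
        ∀ᵐ x ∂μ, ∃! y, NoCollision.Matches S h μ ν x y) ∧
      ∀ p : ℝ, 1 ≤ p →
        -- the map `μ ↦ t_σ^μ` is an injection into `L^p(σ; ℝ^d)`
        (∃ hmem : ∀ μ : NoCollision.calK d,
            MemLp (NoCollision.tMap S h (NoCollision.uniformCube d) μ.1)
              (ENNReal.ofReal p) (NoCollision.uniformCube d),
          Function.Injective (fun μ : NoCollision.calK d => (hmem μ).toLp)) ∧
        -- the integrals that define `W` are finite, and `W` is a metric
        (∀ μ ∈ NoCollision.calK d, ∀ ν ∈ NoCollision.calK d,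
          MemLp (fun x => NoCollision.tMap S h μ ν x - x) (ENNReal.ofReal p) μ) ∧
        ∃ m : MetricSpace (NoCollision.calK d),
          ∀ μ ν : NoCollision.calK d, m.dist μ ν = NoCollision.W S h p μ.1 ν.1 := by
  refine ⟨fun μ _ hμ => NoCollision.exists_isSlicing hμ, fun h hh =>
    ⟨fun μ hμ ν hν => NoCollision.ae_existsUnique_matches hS hμ hν (hh μ hμ) (hh ν hν),
      fun p hp => ?_⟩⟩
  have hσ := NoCollision.uniformCube_mem_calK (d := d)
  have hsσ := hh _ hσ
  have hmem : ∀ μ : NoCollision.calK d,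
      MemLp (NoCollision.tMap S h (NoCollision.uniformCube d) μ.1)
        (ENNReal.ofReal p) (NoCollision.uniformCube d) := fun μ =>
    NoCollision.memLp_tMap hS hσ μ.2 hsσ (hh μ.1 μ.2) _
  have hinj : Function.Injective (fun μ : NoCollision.calK d => (hmem μ).toLp) := by
    intro μ ν hμν
    refine Subtype.ext ?_
    -- The target measure is recovered as the pushforward of σ, which depends only on the a.e. class
    -- of the map.
    rw [← NoCollision.map_tMap hS hσ μ.2 hsσ (hh μ.1 μ.2),
      ← NoCollision.map_tMap hS hσ ν.2 hsσ (hh ν.1 ν.2)]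
    exact Measure.map_congr ((MemLp.toLp_eq_toLp_iff _ _).1 hμν)
  have : Fact (1 ≤ ENNReal.ofReal p) := ⟨by simpa using ENNReal.ofReal_le_ofReal hp⟩
  refine ⟨⟨hmem, hinj⟩, fun μ hμ ν hν =>
    (NoCollision.memLp_tMap hS hμ hν (hh μ hμ) (hh ν hν) _).sub
      (NoCollision.memLp_id_of_mem_calK hμ _), MetricSpace.induced _ hinj inferInstance,
    fun μ ν => ?_⟩
  rw [NoCollision.W_eq_norm_sub hS hσ μ.2 ν.2 hsσ (hh μ.1 μ.2) (hh ν.1 ν.2) hp (hmem ν) (hmem μ),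
    ← dist_eq_norm, dist_comm ((hmem ν).toLp)]
  rfl
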